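/- Let $\mathfrak h$ be a Lie subalgebra of a Lie algebra $\mathfrak g$ over a field $\mathbb K$. Assume that any of the following is true: (i) $\mathfrak h$ is perfect, i.e. $\mathfrak h=[\mathfrak h,\mathfrak h]$ ($\mathbb K$ arbitrary, no restriction on dimensions). (ii) $\mathfrak g$ is finite-dimensional, $\mathbb K$ has characteristic zero, and the radical (maximal solvable ideal) $\mathfrak r_{\mathfrak h}$ of $\mathfrak h$ is contained in the center of $\mathfrak g$. (iii) $\mathbb K=\mathbb R$, $\mathfrak g$ is finite-dimensional, and there is a symmetric bilinear form $B$ on $\mathfrak g$ that is non-degenerate on $\mathfrak h$ and positive definite on the $B$-orthogonal complement $\mathfrak m$ of $\mathfrak h$ in $\mathfrak g$, and such that every operator $\operatorname{ad}_X$, $X\in\mathfrak h$, is skew-symmetric with respect to $B$, i.e. $B([X,Y],Z)+B(Y,[X,Z])=0$ for all $X\in\mathfrak h$ and $Y,Z\in\mathfrak g$. (iv) $\mathbb K=\mathbb R$, $\mathfrak g$ is finite-dimensional and compact, i.e. $\mathfrak g$ is (isomorphic to) the Lie algebra of a compact Lie group. (v) $\mathbb K=\mathbb R$, $\mathfrak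 g$ is finite-dimensional and $\mathfrak h$ is compactly embedded in $\mathfrak g$, i.e. there is an inner product on $\mathfrak g$ with respect to which every operator $\operatorname{ad}_X$, $X\in\mathfrak h$, is skew-symmetric. (vi) $\mathbb K=\mathbb R$, $\mathfrak g$ is finite-dimensional and semisimple with Killing form $B$, and there is a Cartan involution $\theta$ of $\mathfrak g$ (a Lie algebra automorphism with $\theta^2=\operatorname{id}$ such that $\langle X,Y\rangle=-B(X,\theta(Y))$ is positive definite) such that $\mathfrak h$ contains $\{X\in\mathfrak g:\theta(X)=X\}$ or contains $\{X\in\mathfrak g:\theta(X)=-X\}$. Then the normalizer $N_{\mathfrak g}(\mathfrak h)=\{X\in\mathfrak g:[X,Y]\in\mathfrak h\ \text{for all}\ Y\in\mathfrak h\}$ is a self-normalizing subalgebra of $\mathfrak g$, i.e. $N_{\mathfrak g}(\mathfrak h)=N_{\mathfrak g}\big(N_{\mathfrak g}(\mathfrak h)\big)$. -/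

import Mathlib

open scoped Manifold ContDiff

universe u v w

/-- A Lie algebra `L` is perfect if it equals its commutator ideal, `L = [L, L]`. -/
def LiePerfect (K L : Type*) [CommRing K] [LieRing L] [LieAlgebra K L] : Prop :=
  ⁅(⊤ : LieIdeal K L), (⊤ : LieIdeal K L)⁆ = ⊤

/-- A Lie subalgebra is self-normalizing if it equals its own normalizer. -/
def LieSelfNormalizing {K L : Type*} [CommRing K] [LieRing L] [LieAlgebra K L]
    (h : LieSubalgebra K L) : Prop :=
  h = h.normalizer

/-- Every operator `ad X`, `X ∈ h`, is skew-symmetric with respect to the bilinear form `B`. -/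
def LieSkewOn {L : Type*} [LieRing L] [LieAlgebra ℝ L]
    (h : LieSubalgebra ℝ L) (B : LinearMap.BilinForm ℝ L) : Prop :=
  ∀ X ∈ h, ∀ Y Z : L, B ⁅X, Y⁆ Z + B Y ⁅X, Z⁆ = 0

/-- `L` carries a symmetric bilinear form `B` which is nondegenerate on `h` and positive definite
on the `B`-orthogonal complement of `h`, and with respect to which every `ad X`, `X ∈ h`,
is skew-symmetric. -/
def LieHasAdaptedForm {L : Type*} [LieRing L] [LieAlgebra ℝ L] (h : LieSubalgebra ℝ L) : Prop :=
  ∃ B : LinearMap.BilinForm ℝ L, B.IsSymm ∧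
    (B.restrict h.toSubmodule).Nondegenerate ∧
    (∀ x ∈ B.orthogonal h.toSubmodule, x ≠ 0 → 0 < B x x) ∧
    LieSkewOn h B

/-- `h` is compactly embedded in `L`: some inner product on `L` makes every `ad X`, `X ∈ h`,
skew-symmetric. -/
def LieCompactlyEmbedded {L : Type*} [LieRing L] [LieAlgebra ℝ L] (h : LieSubalgebra ℝ L) : Prop :=
  ∃ B : LinearMap.BilinForm ℝ L, B.IsSymm ∧ (∀ x, x ≠ 0 → 0 < B x x) ∧ LieSkewOn h B

/-- Over `ℝ`, a smooth Lie group has the regularity which the Lie algebra structure on its tangent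
space at the identity asks for. -/
theorem lieGroup_minSmoothness (n : ℕ) (G : Type*) [TopologicalSpace G]
    [ChartedSpace (EuclideanSpace ℝ (Fin n)) G] [Group G] [LieGroup (𝓡 n) ∞ G] :
    LieGroup (𝓡 n) (minSmoothness ℝ 3) G := by
  rw [minSmoothness_of_isRCLikeNormedField]
  exact LieGroup.of_le (n := ∞) (ENat.LEInfty.out (m := 3))

/-- `L` is a compact Lie algebra: it is isomorphic to the Lie algebra (the tangent space at the
identity, with the bracket of left-invariant vector fields) of a compact real Lie group. -/
def IsCompactLieAlgebra.{w₁, u₁} (L : Type u₁) [LieRing L] [LieAlgebra ℝ L] : Prop :=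
  ∃ (n : ℕ) (G : Type w₁) (_ : TopologicalSpace G) (_ : ChartedSpace (EuclideanSpace ℝ (Fin n)) G)
    (_ : Group G) (_ : LieGroup (𝓡 n) ∞ G),
    haveI := lieGroup_minSmoothness n G
    T2Space G ∧ CompactSpace G ∧ Nonempty (L ≃ₗ⁅ℝ⁆ GroupLieAlgebra (𝓡 n) G)

/-- `θ` is a Cartan involution: an involutive automorphism such that the form
`⟨X, Y⟩ = -B(X, θ Y)` is positive definite, where `B` is the Killing form. -/
def IsCartanInvolution {L : Type*} [LieRing L] [LieAlgebra ℝ L] (θ : L ≃ₗ⁅ℝ⁆ L) : Prop :=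
  (∀ X, θ (θ X) = X) ∧ ∀ X, X ≠ 0 → 0 < -(killingForm ℝ L X (θ X))

/-! Write N for the normalizer of h. It is enough that every X in N(N) satisfies [X, h] ⊆ h. For A,
B in h the brackets [X, A] and [X, B] lie in N, so the Leibniz rule puts [X, [A, B]] in h. Hence
N(N) always maps [h, h] into h, and the theorem follows whenever h is contained in [h, h] plus the
center of g. This covers perfect h. It also covers h with central radical, because in characteristic
zero h = [h, h] + rad h.

The real cases all reduce to an adapted form B, for which g = h ⊕ m and [h, m] ⊆ m. It suffices to
treat X in m. For Y in h put Z = [Y, X]. Then Z is in m ∩ N, so [Y, Z] is in h ∩ m = 0, and skewness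
gives B(Z, Z) = -B(X, [Y, Z]) = 0. Positivity on m forces Z = 0
(`LieHasAdaptedForm.lieSelfNormalizing`).

An invariant inner product is adapted. With a Cartan involution, the Killing form or its negative is
adapted (`LieHasAdaptedForm.of_cartanInvolution`). For the Lie algebra of a compact group, an inner
product is averaged over the adjoint action with Haar measure. Differentiating its invariance gives
skewness, once the derivative of Ad is known to be the bracket of left-invariant fields
(`fderiv_lieGroupAd`). That is a second-order computation with the group law in a chart. -/

theorem lieSelfNormalizing_normalizer_of_forall_lie_mem {K L : Type*} [CommRing K] [LieRing L]
    [LieAlgebra K L] (h : LieSubalgebra K L)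
    (H : ∀ X ∈ h.normalizer.normalizer, ∀ Y ∈ h, ⁅X, Y⁆ ∈ h) :
    LieSelfNormalizing h.normalizer :=
  le_antisymm h.normalizer.le_normalizer fun X hX ↦ (h.mem_normalizer_iff _).2 (H X hX)

theorem lie_lie_mem_of_mem_normalizer_normalizer {K L : Type*} [CommRing K] [LieRing L]
    [LieAlgebra K L] {h : LieSubalgebra K L} {X A B : L} (hX : X ∈ h.normalizer.normalizer)
    (hA : A ∈ h) (hB : B ∈ h) : ⁅X, ⁅A, B⁆⁆ ∈ h := by
  rw [leibniz_lie]
  have hN := (h.normalizer.mem_normalizer_iff _).1 hX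
  refine add_mem ((h.mem_normalizer_iff _).1 (hN A (h.le_normalizer hA)) B hB) ?_
  rw [← lie_skew]
  exact neg_mem ((h.mem_normalizer_iff _).1 (hN B (h.le_normalizer hB)) A hA)

theorem lieSelfNormalizing_normalizer_of_derived_sup_center {K L : Type*} [CommRing K] [LieRing L]
    [LieAlgebra K L] (h : LieSubalgebra K L)
    (H : ∀ Y : h, ∃ D ∈ ⁅(⊤ : LieIdeal K h), (⊤ : LieIdeal K h)⁆, ∃ C ∈ LieAlgebra.center K L,
      (Y : L) = D + C) :
    LieSelfNormalizing h.normalizer := by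
  refine lieSelfNormalizing_normalizer_of_forall_lie_mem h fun X hX Y hY ↦ ?_
  obtain ⟨D, hD, C, hC, hDC⟩ := H ⟨Y, hY⟩
  have hXC : ⁅X, C⁆ = 0 := (LieModule.mem_maxTrivSubmodule K L L C).1 hC X
  change Y = D + C at hDC
  rw [hDC, lie_add, hXC, add_zero]
  clear hDC
  rw [← LieSubmodule.mem_toSubmodule, LieSubmodule.lieIdeal_oper_eq_linear_span'] at hD
  induction hD using Submodule.span_induction with
  | mem x hx =>
    obtain ⟨a, -, b, -, rfl⟩ := hx
    exact lie_lie_mem_of_mem_normalizer_normalizer hX a.2 b.2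
  | zero => simp
  | add x y _ _ hx hy => simpa using add_mem hx hy
  | smul c x _ hx => simpa using h.smul_mem c hx

/-! ### Derived algebra and radical in characteristic zero. -/

/-- If x is Killing-orthogonal to [L, L], then κ(z, [y, x]) = κ([z, y], x) = 0 for all y, z, so x is
central by nondegeneracy, hence zero. An ideal with zero Killing complement is everything. -/
theorem LieAlgebra.lie_top_top_eq_top_of_isKilling (K L : Type*) [Field K] [LieRing L]
    [LieAlgebra K L] [FiniteDimensional K L] [LieAlgebra.IsKilling K L] :
    ⁅(⊤ : LieIdeal K L), (⊤ : LieIdeal K L)⁆ = ⊤ := by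
  set D := ⁅(⊤ : LieIdeal K L), (⊤ : LieIdeal K L)⁆
  have hbot : LieIdeal.killingCompl K L D = ⊥ := by
    refine (LieSubmodule.eq_bot_iff _).2 fun x hx ↦ ?_
    have hc : x ∈ LieAlgebra.center K L := by
      refine (LieModule.mem_maxTrivSubmodule K L L x).2 fun y ↦ ?_
      have : ⁅y, x⁆ ∈ LieIdeal.killingCompl K L ⊤ := by
        refine (LieIdeal.mem_killingCompl K L ⊤).2 fun z _ ↦ ?_
        have := (LieIdeal.mem_killingCompl K L D).1 hx ⁅z, y⁆
          (LieSubmodule.lie_mem_lie trivial trivial)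
        rwa [killingForm, LieModule.traceForm_apply_lie_apply] at this
      simpa using this
    simpa using hc
  have := LieIdeal.isCompl_killingCompl D
  rw [hbot] at this
  simpa using this.sup_eq_top

/-- The quotient map by an ideal, as a morphism of Lie algebras. -/
def LieIdeal.quotientMk {K L : Type*} [CommRing K] [LieRing L] [LieAlgebra K L]
    (I : LieIdeal K L) : L →ₗ⁅K⁆ L ⧸ I :=
  { (LieSubmodule.Quotient.mk' I : L →ₗ[K] L ⧸ I) with map_lie' := rfl }

theorem LieIdeal.quotientMk_surjective {K L : Type*} [CommRing K] [LieRing L] [LieAlgebra K L]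
    (I : LieIdeal K L) : Function.Surjective I.quotientMk :=
  LieSubmodule.Quotient.surjective_mk' I

theorem LieIdeal.quotientMk_eq_zero {K L : Type*} [CommRing K] [LieRing L] [LieAlgebra K L]
    {I : LieIdeal K L} {x : L} : I.quotientMk x = 0 ↔ x ∈ I :=
  LieSubmodule.Quotient.mk_eq_zero I

theorem LieIdeal.map_derivedSeriesOfIdeal_le {K L L' : Type*} [CommRing K] [LieRing L]
    [LieAlgebra K L] [LieRing L'] [LieAlgebra K L'] (f : L →ₗ⁅K⁆ L') {J : LieIdeal K L}
    {I : LieIdeal K L'} (h : J.map f ≤ I) (k : ℕ) :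
    (LieAlgebra.derivedSeriesOfIdeal K L k J).map f ≤
      LieAlgebra.derivedSeriesOfIdeal K L' k I := by
  induction k with
  | zero => simpa using h
  | succ k ih =>
    rw [LieAlgebra.derivedSeriesOfIdeal_succ, LieAlgebra.derivedSeriesOfIdeal_succ]
    exact (LieIdeal.map_bracket_le f).trans (LieSubmodule.mono_lie ih ih)

/-- An extension of a solvable ideal by the solvable radical R is solvable. So the preimage of a
solvable ideal of L/R lies in R, and that ideal is zero. -/
theorem LieAlgebra.hasTrivialRadical_quotient_radical (K L : Type*) [Field K] [LieRing L]
    [LieAlgebra K L] [FiniteDimensional K L] :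
    LieAlgebra.HasTrivialRadical K (L ⧸ LieAlgebra.radical K L) := by
  set R := LieAlgebra.radical K L
  refine LieAlgebra.hasTrivialRadical_of_no_solvable_ideals fun I hI ↦ ?_
  let J : LieIdeal K L := I.comap R.quotientMk
  obtain ⟨k, hk⟩ := LieAlgebra.IsSolvable.solvable K I
  obtain ⟨l, hl⟩ := LieAlgebra.IsSolvable.solvable K R
  rw [LieIdeal.derivedSeries_eq_bot_iff] at hk hl
  have hJk : LieAlgebra.derivedSeriesOfIdeal K L k J ≤ R := fun x hx ↦ by
    have := LieIdeal.map_derivedSeriesOfIdeal_le R.quotientMk LieIdeal.map_comap_le k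
      (LieIdeal.mem_map hx)
    rw [hk] at this
    exact LieIdeal.quotientMk_eq_zero.1 ((LieSubmodule.mem_bot _).1 this)
  have hJ : LieAlgebra.IsSolvable J := by
    refine LieAlgebra.IsSolvable.mk (R := K) (k := l + k) ?_
    rw [LieIdeal.derivedSeries_eq_bot_iff, LieAlgebra.derivedSeriesOfIdeal_add, eq_bot_iff, ← hl]
    exact LieAlgebra.derivedSeriesOfIdeal_mono hJk l
  refine (LieSubmodule.eq_bot_iff _).2 fun y hy ↦ ?_
  obtain ⟨x, rfl⟩ := R.quotientMk_surjective y
  exact LieIdeal.quotientMk_eq_zero.2 ((LieAlgebra.LieIdeal.solvable_iff_le_radical K L J).1 hJ hy)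

/-- In characteristic zero the quotient by the radical has nondegenerate Killing form, so it is
perfect. Thus every element agrees with one of [L, L] modulo the radical. No Levi complement is
needed. -/
theorem LieAlgebra.derived_sup_radical_eq_top (K L : Type*) [Field K] [CharZero K] [LieRing L]
    [LieAlgebra K L] [FiniteDimensional K L] :
    ⁅(⊤ : LieIdeal K L), (⊤ : LieIdeal K L)⁆ ⊔ LieAlgebra.radical K L = ⊤ := by
  set R := LieAlgebra.radical K L
  have : LieAlgebra.HasTrivialRadical K (L ⧸ R) :=
    LieAlgebra.hasTrivialRadical_quotient_radical K L
  have : FiniteDimensional K (L ⧸ R) :=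
    inferInstanceAs (FiniteDimensional K (L ⧸ R.toSubmodule))
  have htop := LieAlgebra.lie_top_top_eq_top_of_isKilling K (L ⧸ R)
  have hmap := LieIdeal.derivedSeries_map_eq (R := K) 1 R.quotientMk_surjective
  refine eq_top_iff.2 fun x _ ↦ ?_
  have hx : R.quotientMk x ∈ (LieAlgebra.derivedSeries K L 1).map R.quotientMk := by
    rw [hmap]
    simp [htop]
  obtain ⟨y, hy⟩ := LieIdeal.mem_map_of_surjective R.quotientMk_surjective hx
  refine (LieSubmodule.mem_sup _ _ _).2 ⟨y, y.2, x - y, ?_, by simp⟩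
  exact LieIdeal.quotientMk_eq_zero.1 (by simp [hy])

/-! ### Adapted forms and Cartan involutions. -/

theorem LieHasAdaptedForm.lieSelfNormalizing {L : Type*} [LieRing L] [LieAlgebra ℝ L]
    [FiniteDimensional ℝ L] {h : LieSubalgebra ℝ L} (H : LieHasAdaptedForm h) :
    LieSelfNormalizing h.normalizer := by
  obtain ⟨B, hB, hnd, hpos, hskew⟩ := H
  have hrefl : B.IsRefl := hB.isRefl
  have hc := LinearMap.BilinForm.isCompl_orthogonal_of_restrict_nondegenerate hrefl hnd
  set m := B.orthogonal h.toSubmodule with hm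
  have mem_m : ∀ {x}, x ∈ m ↔ ∀ y ∈ h, B y x = 0 := fun {x} ↦ by
    simp [hm, LinearMap.BilinForm.mem_orthogonal_iff]
  have hmm : ∀ X ∈ h, ∀ Y ∈ m, ⁅X, Y⁆ ∈ m := fun X hX Y hY ↦ mem_m.2 fun Z hZ ↦ by
    have := hskew X hX Z Y
    rwa [mem_m.1 hY _ (h.lie_mem hX hZ), zero_add] at this
  have hdisj : ∀ x ∈ h, x ∈ m → x = 0 := fun x hx hx' ↦
    (Submodule.disjoint_def.1 hc.disjoint) x hx hx'
  refine lieSelfNormalizing_normalizer_of_forall_lie_mem h fun X hX Y hY ↦ ?_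
  obtain ⟨X₁, hX₁, X₂, hX₂, rfl⟩ := Submodule.mem_sup.1
    (hc.sup_eq_top ▸ Submodule.mem_top : X ∈ h.toSubmodule ⊔ m)
  have hX₂N : X₂ ∈ h.normalizer.normalizer := by
    have := sub_mem hX (h.normalizer.le_normalizer (h.le_normalizer hX₁))
    simpa using this
  have hZm : ⁅Y, X₂⁆ ∈ m := hmm Y hY X₂ hX₂
  have hZN : ⁅Y, X₂⁆ ∈ h.normalizer := by
    rw [← lie_skew]
    exact neg_mem ((h.normalizer.mem_normalizer_iff _).1 hX₂N Y (h.le_normalizer hY))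
  -- The double bracket is in h because [Y, X₂] normalizes h, and in m because m is ad(h)-stable.
  have hZ0 : ⁅Y, ⁅Y, X₂⁆⁆ = 0 := by
    refine hdisj _ ?_ (hmm Y hY _ hZm)
    rw [← lie_skew]
    exact neg_mem ((h.mem_normalizer_iff _).1 hZN Y hY)
  have hZ : ⁅Y, X₂⁆ = 0 := by
    by_contra hne
    have h1 := hpos _ hZm hne
    have h2 := hskew Y hY X₂ ⁅Y, X₂⁆
    rw [hZ0] at h2
    simp at h2
    exact h1.ne' h2
  rw [add_lie, ← lie_skew X₂ Y, hZ, neg_zero, add_zero]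
  exact h.lie_mem hX₁ hY

theorem LieCompactlyEmbedded.lieHasAdaptedForm {L : Type*} [LieRing L] [LieAlgebra ℝ L]
    {h : LieSubalgebra ℝ L} (H : LieCompactlyEmbedded h) :
    LieHasAdaptedForm h := by
  obtain ⟨B, hB, hpos, hskew⟩ := H
  refine ⟨B, hB, ?_, fun x _ hx ↦ hpos x hx, hskew⟩
  refine LinearMap.BilinForm.nondegenerate_restrict_of_disjoint_orthogonal
    B hB.isRefl (Submodule.disjoint_def.2 fun x hx hx' ↦ ?_)
  by_contra hne
  exact (hpos x hne).ne' (hx' x hx)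

theorem lieSkewOn_killingForm {L : Type*} [LieRing L] [LieAlgebra ℝ L] (h : LieSubalgebra ℝ L) :
    LieSkewOn h (killingForm ℝ L) := fun X _ Y Z ↦ by
  rw [killingForm, LieModule.traceForm_lieInvariant ℝ L L X Y Z, neg_add_cancel]

theorem IsCartanInvolution.exists_eq_add {L : Type*} [LieRing L] [LieAlgebra ℝ L] {θ : L ≃ₗ⁅ℝ⁆ L}
    (hθ : IsCartanInvolution θ) (X : L) :
    ∃ Y Z, θ Y = Y ∧ θ Z = -Z ∧ X = Y + Z := by
  refine ⟨(1 / 2 : ℝ) • (X + θ X), (1 / 2 : ℝ) • (X - θ X), ?_, ?_, ?_⟩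
  · simp [hθ.1, add_comm]
  · simp [hθ.1, ← smul_neg]
  · module

/-- Let k and p be the eigenspaces of θ for 1 and -1. They are Killing-orthogonal, and the Killing
form is negative definite on k and positive definite on p. If h contains k, its orthogonal
complement lies in p and the Killing form is adapted. If h contains p, the complement lies in k and
the negative of the Killing form is adapted. -/
theorem LieHasAdaptedForm.of_cartanInvolution {L : Type*} [LieRing L] [LieAlgebra ℝ L]
    [FiniteDimensional ℝ L] {h : LieSubalgebra ℝ L} {θ : L ≃ₗ⁅ℝ⁆ L}
    (hθ : IsCartanInvolution θ)
    (H : (∀ x, θ x = x → x ∈ h) ∨ (∀ x, θ x = -x → x ∈ h)) : LieHasAdaptedForm h := by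
  -- If h contains one eigenspace, both components of an element of h lie in h, hence so does their
  -- difference.
  have hstab : ∀ x ∈ h, θ x ∈ h := by
    intro x hx
    obtain ⟨y, z, hy, hz, rfl⟩ := hθ.exists_eq_add x
    rcases H with H | H
    · have hzh : z ∈ h := by simpa using sub_mem hx (H y hy)
      simpa [hy, hz, sub_eq_add_neg] using sub_mem (H y hy) hzh
    · have hyh : y ∈ h := by simpa using sub_mem hx (H z hz)
      simpa [hy, hz, sub_eq_add_neg] using sub_mem hyh (H z hz)
  have hsymm : (killingForm ℝ L).IsSymm := ⟨LieModule.traceForm_comm ℝ L L⟩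
  have hinv : ∀ x y, killingForm ℝ L (θ x) (θ y) = killingForm ℝ L x y := fun x y ↦ by
    exact LieAlgebra.killingForm_of_equiv_apply θ x y
  -- An x in h orthogonal to h is orthogonal to θ x, which contradicts positivity unless x = 0.
  have hnd : ((killingForm ℝ L).restrict h.toSubmodule).Nondegenerate := by
    refine LinearMap.BilinForm.nondegenerate_restrict_of_disjoint_orthogonal
      _ hsymm.isRefl (Submodule.disjoint_def.2 fun x hx hx' ↦ ?_)
    by_contra hne
    have h1 := hθ.2 x hne
    have h2 : killingForm ℝ L (θ x) x = 0 := hx' (θ x) (hstab x hx)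
    rw [LieModule.traceForm_comm] at h2
    rw [h2] at h1
    simp at h1
  have hxy : ∀ x y, θ x = x → θ y = -y → killingForm ℝ L x y = 0 := fun x y hx hy ↦ by
    have := hinv x y
    rw [hx, hy, map_neg] at this
    linarith
  rcases H with H | H
  · refine ⟨killingForm ℝ L, hsymm, hnd, fun x hx hx0 ↦ ?_, lieSkewOn_killingForm h⟩
    have hθx : θ x = -x := by
      obtain ⟨y, z, hy, hz, rfl⟩ := hθ.exists_eq_add x
      have h1 : killingForm ℝ L y (y + z) = 0 := hx y (H y hy)
      rw [map_add, hxy y z hy hz, add_zero] at h1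
      have hy0 : y = 0 := by
        by_contra hne
        have := hθ.2 y hne
        rw [hy, h1] at this
        simp at this
      simp [hy0, hz]
    simpa [hθx] using hθ.2 x hx0
  · have hθx : ∀ x ∈ (killingForm ℝ L).orthogonal h.toSubmodule, θ x = x := by
      intro x hx
      obtain ⟨y, z, hy, hz, rfl⟩ := hθ.exists_eq_add x
      have h1 : killingForm ℝ L z (y + z) = 0 := hx z (H z hz)
      rw [map_add, LieModule.traceForm_comm ℝ L L z y, hxy y z hy hz, zero_add] at h1
      have hz0 : z = 0 := by
        by_contra hne
        have := hθ.2 z hne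
        rw [hz, map_neg, h1] at this
        simp at this
      simp [hz0, hy]
    refine ⟨-killingForm ℝ L, ⟨fun x y ↦ ?_⟩, ?_, fun x hx hx0 ↦ ?_, fun X hX Y Z ↦ ?_⟩
    · simpa using LieModule.traceForm_comm ℝ L L x y
    · refine ⟨fun x hx ↦ hnd.1 x fun y ↦ ?_, fun y hy ↦ hnd.2 y fun x ↦ ?_⟩
      · simpa using hx y
      · simpa using hy x
    · have hx' : x ∈ (killingForm ℝ L).orthogonal h.toSubmodule := fun y hy ↦ by
        simpa using hx y hy
      simpa [hθx x hx'] using hθ.2 x hx0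
    · have := lieSkewOn_killingForm h X hX Y Z
      simp only [LinearMap.neg_apply]
      linarith

/-! ### Perfect subalgebras and subalgebras with central radical. -/

theorem lieSelfNormalizing_normalizer_of_perfect {K L : Type*} [CommRing K] [LieRing L]
    [LieAlgebra K L] {h : LieSubalgebra K L} (H : LiePerfect K h) :
    LieSelfNormalizing h.normalizer := by
  refine lieSelfNormalizing_normalizer_of_derived_sup_center h fun Y ↦
    ⟨Y, ?_, 0, zero_mem _, by simp⟩
  rw [show ⁅(⊤ : LieIdeal K h), (⊤ : LieIdeal K h)⁆ = ⊤ from H]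
  trivial

theorem lieSelfNormalizing_normalizer_of_radical_le_center {K L : Type*} [Field K] [CharZero K]
    [LieRing L] [LieAlgebra K L] [FiniteDimensional K L] {h : LieSubalgebra K L}
    (H : ∀ x ∈ LieAlgebra.radical K h, (x : L) ∈ LieAlgebra.center K L) :
    LieSelfNormalizing h.normalizer := by
  have : FiniteDimensional K h := inferInstanceAs (FiniteDimensional K h.toSubmodule)
  refine lieSelfNormalizing_normalizer_of_derived_sup_center h fun Y ↦ ?_
  have hY : Y ∈ ⁅(⊤ : LieIdeal K h), (⊤ : LieIdeal K h)⁆ ⊔ LieAlgebra.radical K h := by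
    rw [LieAlgebra.derived_sup_radical_eq_top]
    trivial
  obtain ⟨D, hD, C, hC, rfl⟩ := (LieSubmodule.mem_sup _ _ _).1 hY
  exact ⟨D, hD, C, H C hC, rfl⟩

/-! ### The adjoint action to second order in a local group. -/

open Filter Topology in
/-- For a local group law `m` with unit `p`, the derivative of the adjoint action (`c` is the
conjugation) is the antisymmetrization of the second derivative of `m`. -/
theorem fderiv_conj_of_local_group_law {E : Type*} [NormedAddCommGroup E] [NormedSpace ℝ E]
    {m c : E × E → E} {p : E} (hm : ContDiffAt ℝ 2 m (p, p)) (hc : ContDiffAt ℝ 2 c (p, p))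
    (hm₁ : ∀ᶠ x in 𝓝 p, m (x, p) = x) (hm₂ : ∀ᶠ x in 𝓝 p, m (p, x) = x)
    (hcp : ∀ᶠ x in 𝓝 p, c (x, p) = p)
    (hcm : ∀ᶠ z in 𝓝 (p, p), m (c z, z.1) = m z) (X Y : E) :
    fderiv ℝ (fun x ↦ fderiv ℝ c (x, p) (0, Y)) p X =
      fderiv ℝ (fun x ↦ fderiv ℝ m (x, p) (0, Y)) p X -
        fderiv ℝ (fun x ↦ fderiv ℝ m (x, p) (0, X)) p Y := by
  have hcpp : c (p, p) = p := hcp.self_of_nhds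
  have hmd : DifferentiableAt ℝ (fderiv ℝ m) (p, p) :=
    (hm.fderiv_right (m := 1) (by norm_num)).differentiableAt (by norm_num)
  have hcd : DifferentiableAt ℝ (fderiv ℝ c) (p, p) :=
    (hc.fderiv_right (m := 1) (by norm_num)).differentiableAt (by norm_num)
  have hsymm : IsSymmSndFDerivAt ℝ m (p, p) := hm.isSymmSndFDerivAt (by simp)
  have hl : HasFDerivAt (fun x : E ↦ (x, p)) (ContinuousLinearMap.inl ℝ E E) p :=
    hasFDerivAt_prodMk_left p p
  have hr : HasFDerivAt (fun x : E ↦ (p, x)) (ContinuousLinearMap.inr ℝ E E) p :=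
    hasFDerivAt_prodMk_right p p
  have hmdl : ∀ v, HasFDerivAt (fun x ↦ fderiv ℝ m (x, p) v)
      (((fderiv ℝ (fderiv ℝ m) (p, p)).flip v).comp (ContinuousLinearMap.inl ℝ E E)) p := fun v ↦
    ((ContinuousLinearMap.apply ℝ E v).hasFDerivAt.comp p
      (hmd.hasFDerivAt.comp (f := fun x ↦ (x, p)) p hl)).congr_fderiv (by ext; rfl)
  have hcdl : ∀ v, HasFDerivAt (fun x ↦ fderiv ℝ c (x, p) v)
      (((fderiv ℝ (fderiv ℝ c) (p, p)).flip v).comp (ContinuousLinearMap.inl ℝ E E)) p := fun v ↦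
    ((ContinuousLinearMap.apply ℝ E v).hasFDerivAt.comp p
      (hcd.hasFDerivAt.comp (f := fun x ↦ (x, p)) p hl)).congr_fderiv (by ext; rfl)
  have hmdr : HasFDerivAt (fun x ↦ fderiv ℝ m (p, x))
      ((fderiv ℝ (fderiv ℝ m) (p, p)).comp (ContinuousLinearMap.inr ℝ E E)) p :=
    hmd.hasFDerivAt.comp p hr
  have hm1 : ∀ v, fderiv ℝ m (p, p) (v, 0) = v := fun v ↦ by
    have h1 : HasFDerivAt (fun x ↦ m (x, p)) _ p :=
      (hm.differentiableAt (by norm_num)).hasFDerivAt.comp (f := fun x ↦ (x, p)) p hl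
    have h2 : HasFDerivAt (fun x ↦ m (x, p)) (ContinuousLinearMap.id ℝ E) p :=
      (hasFDerivAt_id p).congr_of_eventuallyEq hm₁
    simpa using congr($(h1.unique h2) v)
  have hm2 : ∀ v, fderiv ℝ m (p, p) (0, v) = v := fun v ↦ by
    have h1 : HasFDerivAt (fun x ↦ m (p, x)) _ p :=
      (hm.differentiableAt (by norm_num)).hasFDerivAt.comp p hr
    have h2 : HasFDerivAt (fun x ↦ m (p, x)) (ContinuousLinearMap.id ℝ E) p :=
      (hasFDerivAt_id p).congr_of_eventuallyEq hm₂
    simpa using congr($(h1.unique h2) v)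
  have hc2 : ∀ v, fderiv ℝ c (p, p) (0, v) = v := fun v ↦ by
    have h1 : HasFDerivAt (fun x ↦ c (p, x)) _ p :=
      (hc.differentiableAt (by norm_num)).hasFDerivAt.comp p hr
    have hcont : Tendsto (fun x ↦ c (p, x)) (𝓝 p) (𝓝 p) := by
      simpa [ContinuousAt, hcpp] using h1.continuousAt
    have hmap : Tendsto (fun x : E ↦ (p, x)) (𝓝 p) (𝓝 (p, p)) := hr.continuousAt
    have h2 : HasFDerivAt (fun x ↦ c (p, x)) (ContinuousLinearMap.id ℝ E) p := by
      refine (hasFDerivAt_id p).congr_of_eventuallyEq ?_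
      filter_upwards [hm₂, hcont.eventually hm₁, hmap.eventually hcm] with x h3 h4 h5
      simpa [h3, h4] using h5
    simpa using congr($(h1.unique h2) v)
  -- This is m(c(x, y), x) = m(x, y), that is (xyx⁻¹)x = xy, differentiated in y at p in the
  -- direction Y, using c(x, p) = p.
  have key : (fun x ↦ fderiv ℝ m (p, x) (fderiv ℝ c (x, p) (0, Y), 0)) =ᶠ[𝓝 p]
      fun x ↦ fderiv ℝ m (x, p) (0, Y) := by
    have hmapl : Tendsto (fun x : E ↦ (x, p)) (𝓝 p) (𝓝 (p, p)) := hl.continuousAt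
    have hmapr : Tendsto (fun x : E ↦ (p, x)) (𝓝 p) (𝓝 (p, p)) := hr.continuousAt
    filter_upwards [hmapl.eventually hcm.eventually_nhds, hcp,
      hmapr.eventually (hm.eventually (by simp)), hmapl.eventually (hc.eventually (by simp))]
      with x h1 h2 h3 h4
    have h5 : HasFDerivAt c (fderiv ℝ c (x, p)) (x, p) :=
      (h4.differentiableAt (by norm_num)).hasFDerivAt
    have h6 : HasFDerivAt m (fderiv ℝ m (p, x)) (c (x, p), (x, p).1) := by
      rw [h2]
      exact (h3.differentiableAt (by norm_num)).hasFDerivAt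
    have h7 : HasFDerivAt (fun z ↦ m (c z, z.1)) _ (x, p) :=
      h6.comp (f := fun z ↦ (c z, z.1)) (x, p) (h5.prodMk hasFDerivAt_fst)
    rw [(h7.congr_of_eventuallyEq (h1.mono fun _ h ↦ h.symm)).fderiv]
    simp
  -- Differentiating `key` in x along X gives D²m((0, X), (Y, 0)) + D²c((X, 0), (0, Y)) = D²m((X,
  -- 0), (0, Y)). Symmetry of D²m turns the first term into D²m((Y, 0), (0, X)).
  have hder := (hmdr.clm_apply
    (((ContinuousLinearMap.inl ℝ E E).hasFDerivAt).comp p (hcdl (0, Y)))).unique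
      (((hmdl (0, Y)).congr_of_eventuallyEq key))
  have h3 := congr($hder X)
  rw [(hmdl _).fderiv, (hmdl _).fderiv, (hcdl _).fderiv]
  simp [hc2, hm1] at h3 ⊢
  rw [← h3, hsymm.eq]
  simp

/-! ### Lie groups in the chart at the identity: Ad and the bracket. -/

section LocalLieGroup
open Filter Topology VectorField
variable {E : Type*} [NormedAddCommGroup E] [NormedSpace ℝ E]
  {G : Type*} [TopologicalSpace G] [ChartedSpace E G] [Group G]

variable (E G) in
/-- The multiplication of a Lie group read in the chart at the identity. -/
noncomputable def chartMul (z : E × E) : E :=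
  extChartAt 𝓘(ℝ, E) (1 : G)
    ((extChartAt 𝓘(ℝ, E) (1 : G)).symm z.1 * (extChartAt 𝓘(ℝ, E) (1 : G)).symm z.2)

variable (E G) in
/-- The conjugation of a Lie group read in the chart at the identity. -/
noncomputable def chartConj (z : E × E) : E :=
  extChartAt 𝓘(ℝ, E) (1 : G)
    ((extChartAt 𝓘(ℝ, E) (1 : G)).symm z.1 * (extChartAt 𝓘(ℝ, E) (1 : G)).symm z.2 *
      ((extChartAt 𝓘(ℝ, E) (1 : G)).symm z.1)⁻¹)

variable (E) in
/-- The adjoint action of a Lie group on its tangent space at the identity. -/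
noncomputable def lieGroupAd (g : G) : E →L[ℝ] E :=
  mfderiv 𝓘(ℝ, E) 𝓘(ℝ, E) (fun y : G ↦ g * y * g⁻¹) 1

theorem eventually_extChartAt_one_symm_mem {s : Set G} (hs : s ∈ 𝓝 (1 : G)) :
    ∀ᶠ x in 𝓝 (extChartAt 𝓘(ℝ, E) (1 : G) 1), (extChartAt 𝓘(ℝ, E) (1 : G)).symm x ∈ s := by
  have := continuousAt_extChartAt_symm (I := 𝓘(ℝ, E)) (1 : G)
  exact this.eventually (by simpa using hs)

theorem eventually_extChartAt_one_mem_target :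
    ∀ᶠ x in 𝓝 (extChartAt 𝓘(ℝ, E) (1 : G) 1), x ∈ (extChartAt 𝓘(ℝ, E) (1 : G)).target :=
  extChartAt_target_mem_nhds (1 : G)

theorem extChartAt_one_symm_self :
    (extChartAt 𝓘(ℝ, E) (1 : G)).symm (extChartAt 𝓘(ℝ, E) (1 : G) 1) = 1 := by
  simp

theorem chartMul_left_eventually : ∀ᶠ x in 𝓝 (extChartAt 𝓘(ℝ, E) (1 : G) 1),
    chartMul E G (extChartAt 𝓘(ℝ, E) (1 : G) 1, x) = x := by
  filter_upwards [eventually_extChartAt_one_mem_target (E := E) (G := G)] with x hx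
  rw [chartMul, extChartAt_one_symm_self, one_mul, PartialEquiv.right_inv _ hx]

theorem chartMul_right_eventually : ∀ᶠ x in 𝓝 (extChartAt 𝓘(ℝ, E) (1 : G) 1),
    chartMul E G (x, extChartAt 𝓘(ℝ, E) (1 : G) 1) = x := by
  filter_upwards [eventually_extChartAt_one_mem_target (E := E) (G := G)] with x hx
  rw [chartMul, extChartAt_one_symm_self, mul_one, PartialEquiv.right_inv _ hx]

variable [LieGroup 𝓘(ℝ, E) ∞ G]

theorem contMDiffAt_extChartAt_one_symm :
    ContMDiffAt 𝓘(ℝ, E) 𝓘(ℝ, E) ∞ (extChartAt 𝓘(ℝ, E) (1 : G)).symm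
      (extChartAt 𝓘(ℝ, E) (1 : G) 1) :=
  (contMDiffOn_extChartAt_symm (1 : G)).contMDiffAt (extChartAt_target_mem_nhds (1 : G))

theorem contMDiffAt_chart_symm_fst : ContMDiffAt 𝓘(ℝ, E × E) 𝓘(ℝ, E) ∞
    (fun z : E × E ↦ (extChartAt 𝓘(ℝ, E) (1 : G)).symm z.1)
    (extChartAt 𝓘(ℝ, E) (1 : G) 1, extChartAt 𝓘(ℝ, E) (1 : G) 1) :=
  ContMDiffAt.comp (extChartAt 𝓘(ℝ, E) (1 : G) 1, extChartAt 𝓘(ℝ, E) (1 : G) 1) (I' := 𝓘(ℝ, E))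
    (g := (extChartAt 𝓘(ℝ, E) (1 : G)).symm) (f := Prod.fst)
    contMDiffAt_extChartAt_one_symm contDiff_fst.contMDiff.contMDiffAt

theorem contMDiffAt_chart_symm_snd : ContMDiffAt 𝓘(ℝ, E × E) 𝓘(ℝ, E) ∞
    (fun z : E × E ↦ (extChartAt 𝓘(ℝ, E) (1 : G)).symm z.2)
    (extChartAt 𝓘(ℝ, E) (1 : G) 1, extChartAt 𝓘(ℝ, E) (1 : G) 1) :=
  ContMDiffAt.comp (extChartAt 𝓘(ℝ, E) (1 : G) 1, extChartAt 𝓘(ℝ, E) (1 : G) 1) (I' := 𝓘(ℝ, E))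
    (g := (extChartAt 𝓘(ℝ, E) (1 : G)).symm) (f := Prod.snd)
    contMDiffAt_extChartAt_one_symm contDiff_snd.contMDiff.contMDiffAt

theorem contDiffAt_chartMul :
    ContDiffAt ℝ 2 (chartMul E G) (extChartAt 𝓘(ℝ, E) (1 : G) 1, extChartAt 𝓘(ℝ, E) (1 : G) 1) := by
  have h : ContMDiffAt 𝓘(ℝ, E × E) 𝓘(ℝ, E) ∞ (chartMul E G)
      (extChartAt 𝓘(ℝ, E) (1 : G) 1, extChartAt 𝓘(ℝ, E) (1 : G) 1) :=
    ContMDiffAt.comp (extChartAt 𝓘(ℝ, E) (1 : G) 1, extChartAt 𝓘(ℝ, E) (1 : G) 1)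
      (I' := 𝓘(ℝ, E)) (g := extChartAt 𝓘(ℝ, E) (1 : G)) (contMDiffAt_extChartAt' (by simp))
      (contMDiffAt_chart_symm_fst.mul contMDiffAt_chart_symm_snd)
  exact h.contDiffAt.of_le ENat.LEInfty.out

theorem contDiffAt_chartConj :
    ContDiffAt ℝ 2 (chartConj E G) (extChartAt 𝓘(ℝ, E) (1 : G) 1, extChartAt 𝓘(ℝ, E) (1 : G) 1) := by
  have h : ContMDiffAt 𝓘(ℝ, E × E) 𝓘(ℝ, E) ∞ (chartConj E G)
      (extChartAt 𝓘(ℝ, E) (1 : G) 1, extChartAt 𝓘(ℝ, E) (1 : G) 1) :=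
    ContMDiffAt.comp (extChartAt 𝓘(ℝ, E) (1 : G) 1, extChartAt 𝓘(ℝ, E) (1 : G) 1)
      (I' := 𝓘(ℝ, E)) (g := extChartAt 𝓘(ℝ, E) (1 : G)) (contMDiffAt_extChartAt' (by simp))
      ((contMDiffAt_chart_symm_fst.mul contMDiffAt_chart_symm_snd).mul
        contMDiffAt_chart_symm_fst.inv)
  exact h.contDiffAt.of_le ENat.LEInfty.out

/-- The derivative at the identity of a map read in the chart at the identity. -/
theorem hasFDerivAt_chart_comp {f : G → G}
    (hf : MDifferentiableAt 𝓘(ℝ, E) 𝓘(ℝ, E) f 1) (hf1 : f 1 ∈ (chartAt E (1 : G)).source) :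
    HasFDerivAt (fun x ↦ extChartAt 𝓘(ℝ, E) (1 : G) (f ((extChartAt 𝓘(ℝ, E) (1 : G)).symm x)))
      ((mfderiv 𝓘(ℝ, E) 𝓘(ℝ, E) (extChartAt 𝓘(ℝ, E) (1 : G)) (f 1) : E →L[ℝ] E) ∘L
        (mfderiv 𝓘(ℝ, E) 𝓘(ℝ, E) f 1 : E →L[ℝ] E)) (extChartAt 𝓘(ℝ, E) (1 : G) 1) := by
  have : IsManifold 𝓘(ℝ, E) 1 G := .of_le (n := ∞) ENat.LEInfty.out
  have h0 : (extChartAt 𝓘(ℝ, E) (1 : G)).symm (extChartAt 𝓘(ℝ, E) (1 : G) 1) = 1 := by simp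
  have h1 : HasMFDerivAt 𝓘(ℝ, E) 𝓘(ℝ, E) (extChartAt 𝓘(ℝ, E) (1 : G)).symm
      (extChartAt 𝓘(ℝ, E) (1 : G) 1) (ContinuousLinearMap.id ℝ E) := by
    have h := (mdifferentiableWithinAt_extChartAt_symm
      (I := 𝓘(ℝ, E)) (mem_extChartAt_target (1 : G))).hasMFDerivWithinAt
    rw [mfderivWithin_range_extChartAt_symm] at h
    rw [ModelWithCorners.range_eq_univ] at h
    exact hasMFDerivWithinAt_univ.1 h
  have h2 := (mdifferentiableAt_extChartAt (I := 𝓘(ℝ, E)) hf1).hasMFDerivAt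
  have h3 : HasMFDerivAt 𝓘(ℝ, E) 𝓘(ℝ, E) (fun y ↦ extChartAt 𝓘(ℝ, E) (1 : G) (f y))
    ((extChartAt 𝓘(ℝ, E) (1 : G)).symm (extChartAt 𝓘(ℝ, E) (1 : G) 1))
      ((mfderiv 𝓘(ℝ, E) 𝓘(ℝ, E) (extChartAt 𝓘(ℝ, E) (1 : G)) (f 1) : E →L[ℝ] E) ∘L
        (mfderiv 𝓘(ℝ, E) 𝓘(ℝ, E) f 1 : E →L[ℝ] E)) := by
    rw [h0]
    exact h2.comp 1 hf.hasMFDerivAt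
  have h4 := h3.comp (extChartAt 𝓘(ℝ, E) (1 : G) 1) h1
  exact h4.hasFDerivAt

/-- The left-invariant field at g is the derivative at 1 of left translation by g, so in the chart
it becomes a partial derivative of the group law in its second variable. -/
theorem fderiv_chartMul_apply :
    ∀ᶠ x in 𝓝 (extChartAt 𝓘(ℝ, E) (1 : G) 1), ∀ v : E,
      fderiv ℝ (chartMul E G) (x, extChartAt 𝓘(ℝ, E) (1 : G) 1) (0, v) =
        (mfderiv 𝓘(ℝ, E) 𝓘(ℝ, E) (extChartAt 𝓘(ℝ, E) (1 : G))
          ((extChartAt 𝓘(ℝ, E) (1 : G)).symm x) : E →L[ℝ] E)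
          (mulInvariantVectorField (I := 𝓘(ℝ, E)) v ((extChartAt 𝓘(ℝ, E) (1 : G)).symm x)) := by
  have hmap : Tendsto (fun x : E ↦ (x, extChartAt 𝓘(ℝ, E) (1 : G) 1))
      (𝓝 (extChartAt 𝓘(ℝ, E) (1 : G) 1))
      (𝓝 (extChartAt 𝓘(ℝ, E) (1 : G) 1, extChartAt 𝓘(ℝ, E) (1 : G) 1)) :=
    ContinuousAt.prodMk continuousAt_id continuousAt_const
  filter_upwards [hmap.eventually (contDiffAt_chartMul.eventually (by simp)),
    eventually_extChartAt_one_symm_mem (E := E) (chart_source_mem_nhds E (1 : G))] with x h1 h2 v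
  set g := (extChartAt 𝓘(ℝ, E) (1 : G)).symm x with hg
  have hf : MDifferentiableAt 𝓘(ℝ, E) 𝓘(ℝ, E) (g * ·) 1 :=
    (contMDiff_mul_left (I := 𝓘(ℝ, E)) (n := ∞)).contMDiffAt.mdifferentiableAt (by simp)
  have h3 := hasFDerivAt_chart_comp hf (by simpa using h2)
  have h4 : HasFDerivAt (fun y ↦ chartMul E G (x, y)) _ (extChartAt 𝓘(ℝ, E) (1 : G) 1) :=
    (h1.differentiableAt (by norm_num)).hasFDerivAt.comp _ (hasFDerivAt_prodMk_right _ _)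
  have h5 := congr($(h4.unique h3) v)
  have h6 : ∀ a : G, a = g →
    (mfderiv 𝓘(ℝ, E) 𝓘(ℝ, E) (extChartAt 𝓘(ℝ, E) (1 : G)) a : E →L[ℝ] E) =
      (mfderiv 𝓘(ℝ, E) 𝓘(ℝ, E) (extChartAt 𝓘(ℝ, E) (1 : G)) g : E →L[ℝ] E) := by
    rintro _ rfl
    rfl
  rw [h6 (g * 1) (mul_one g)] at h5
  simpa using! h5

theorem mdifferentiableAt_conj (g x : G) :
    MDifferentiableAt 𝓘(ℝ, E) 𝓘(ℝ, E) (fun y : G ↦ g * y * g⁻¹) x := by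
  have : ContMDiff 𝓘(ℝ, E) 𝓘(ℝ, E) ∞ (fun y : G ↦ g * y * g⁻¹) :=
    (contMDiff_const.mul contMDiff_id).mul contMDiff_const
  exact this.contMDiffAt.mdifferentiableAt (by simp)

theorem hasMFDerivAt_conj (g : G) :
    HasMFDerivAt 𝓘(ℝ, E) 𝓘(ℝ, E) (fun y : G ↦ g * y * g⁻¹) 1 (lieGroupAd E g) :=
  (mdifferentiableAt_conj g 1).hasMFDerivAt

theorem fderiv_chartConj_apply :
    ∀ᶠ x in 𝓝 (extChartAt 𝓘(ℝ, E) (1 : G) 1), ∀ v : E,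
      fderiv ℝ (chartConj E G) (x, extChartAt 𝓘(ℝ, E) (1 : G) 1) (0, v) =
        lieGroupAd E ((extChartAt 𝓘(ℝ, E) (1 : G)).symm x) v := by
  have : IsManifold 𝓘(ℝ, E) 1 G := .of_le (n := ∞) ENat.LEInfty.out
  have hmap : Tendsto (fun x : E ↦ (x, extChartAt 𝓘(ℝ, E) (1 : G) 1))
      (𝓝 (extChartAt 𝓘(ℝ, E) (1 : G) 1))
      (𝓝 (extChartAt 𝓘(ℝ, E) (1 : G) 1, extChartAt 𝓘(ℝ, E) (1 : G) 1)) :=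
    ContinuousAt.prodMk continuousAt_id continuousAt_const
  filter_upwards [hmap.eventually (contDiffAt_chartConj.eventually (by simp))] with x h1 v
  set g := (extChartAt 𝓘(ℝ, E) (1 : G)).symm x with hg
  have h3 := hasFDerivAt_chart_comp (mdifferentiableAt_conj (E := E) g 1) (by simp)
  have h4 : HasFDerivAt (fun y ↦ chartConj E G (x, y)) _ (extChartAt 𝓘(ℝ, E) (1 : G) 1) :=
    (h1.differentiableAt (by norm_num)).hasFDerivAt.comp _ (hasFDerivAt_prodMk_right _ _)
  have h5 := congr($(h4.unique h3) v)
  have h6 : ∀ a : G, a = 1 →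
    (mfderiv 𝓘(ℝ, E) 𝓘(ℝ, E) (extChartAt 𝓘(ℝ, E) (1 : G)) a : E →L[ℝ] E) =
      ContinuousLinearMap.id ℝ E := by
    rintro _ rfl
    exact mfderiv_extChartAt_self
  rw [h6 (g * 1 * g⁻¹) (by simp)] at h5
  simpa using! h5

theorem lieGroupAd_mul (g h : G) : lieGroupAd E (g * h) = lieGroupAd E g ∘L lieGroupAd E h := by
  have h1 : HasMFDerivAt 𝓘(ℝ, E) 𝓘(ℝ, E) (fun y : G ↦ g * y * g⁻¹) (h * 1 * h⁻¹)
      (lieGroupAd E g) := by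
    rw [show h * 1 * h⁻¹ = 1 by simp]
    exact hasMFDerivAt_conj g
  have h2 := h1.comp 1 (hasMFDerivAt_conj h)
  have h3 : (fun y : G ↦ g * y * g⁻¹) ∘ (fun y : G ↦ h * y * h⁻¹) =
      fun y ↦ (g * h) * y * (g * h)⁻¹ := by
    ext y
    simp [mul_assoc]
  rw [h3] at h2
  exact hasMFDerivAt_unique (hasMFDerivAt_conj (g * h)) h2

theorem lieGroupAd_one : lieGroupAd E (1 : G) = ContinuousLinearMap.id ℝ E := by
  have h1 := hasMFDerivAt_conj (E := E) (1 : G)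
  have h2 : (fun y : G ↦ 1 * y * 1⁻¹) = id := by
    ext y
    simp
  rw [h2] at h1
  exact hasMFDerivAt_unique h1 (hasMFDerivAt_id 1)

theorem differentiableAt_fderiv_chartConj (v : E) :
    DifferentiableAt ℝ (fun x ↦ fderiv ℝ (chartConj E G) (x, extChartAt 𝓘(ℝ, E) (1 : G) 1) (0, v))
      (extChartAt 𝓘(ℝ, E) (1 : G) 1) := by
  have h1 := ((contDiffAt_chartConj (E := E) (G := G)).fderiv_right
    (m := 1) (by norm_num)).differentiableAt (by norm_num)
  have h2 : DifferentiableAt ℝ (fun x : E ↦ (x, extChartAt 𝓘(ℝ, E) (1 : G) 1))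
    (extChartAt 𝓘(ℝ, E) (1 : G) 1) := by fun_prop
  exact (DifferentiableAt.comp (f := fun x : E ↦ (x, extChartAt 𝓘(ℝ, E) (1 : G) 1))
    _ h1 h2).clm_apply (differentiableAt_const _)

theorem differentiableAt_lieGroupAd (v : E) :
    DifferentiableAt ℝ (fun x ↦ lieGroupAd E ((extChartAt 𝓘(ℝ, E) (1 : G)).symm x) v)
      (extChartAt 𝓘(ℝ, E) (1 : G) 1) :=
  (differentiableAt_fderiv_chartConj v).congr_of_eventuallyEq
    (fderiv_chartConj_apply.mono fun _ h ↦ (h v).symm)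

/-- Continuity at 1 comes from differentiability in the chart. It is moved to any g by Ad(k)v =
Ad(kg⁻¹)(Ad(g)v). -/
theorem continuous_lieGroupAd (v : E) : Continuous fun g : G ↦ lieGroupAd E g v := by
  have : IsTopologicalGroup G := topologicalGroup_of_lieGroup 𝓘(ℝ, E) ∞
  have h1 : ∀ v : E, ContinuousAt (fun g : G ↦ lieGroupAd E g v) 1 := fun v ↦ by
    have h2 := (differentiableAt_lieGroupAd (G := G) v).continuousAt
    have h3 := h2.comp (continuousAt_extChartAt (I := 𝓘(ℝ, E)) (1 : G))
    refine h3.congr ?_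
    filter_upwards [extChartAt_source_mem_nhds (I := 𝓘(ℝ, E)) (1 : G)] with g hg
    simp only [Function.comp_apply, (extChartAt 𝓘(ℝ, E) (1 : G)).left_inv hg]
  refine continuous_iff_continuousAt.2 fun g ↦ ?_
  have h2 : ContinuousAt (fun k : G ↦ lieGroupAd E (k * g⁻¹) (lieGroupAd E g v)) g := by
    refine ContinuousAt.comp (f := fun k : G ↦ k * g⁻¹)
      (g := fun k : G ↦ lieGroupAd E k (lieGroupAd E g v)) ?_ (by fun_prop)
    rw [mul_inv_cancel]
    exact h1 _
  refine h2.congr (Eventually.of_forall fun k ↦ ?_)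
  simp [← ContinuousLinearMap.comp_apply, ← lieGroupAd_mul]

theorem mpullbackWithin_mulInvariantVectorField_eventuallyEq
    (v : GroupLieAlgebra 𝓘(ℝ, E) G) :
    (mpullbackWithin 𝓘(ℝ, E) 𝓘(ℝ, E) (extChartAt 𝓘(ℝ, E) (1 : G)).symm
      (mulInvariantVectorField v) (Set.range 𝓘(ℝ, E)) : E → E)
      =ᶠ[𝓝 (extChartAt 𝓘(ℝ, E) (1 : G) 1)]
      fun x ↦ fderiv ℝ (chartMul E G) (x, extChartAt 𝓘(ℝ, E) (1 : G) 1) (0, v) := by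
  have : IsManifold 𝓘(ℝ, E) 1 G := .of_le (n := ∞) ENat.LEInfty.out
  filter_upwards [fderiv_chartMul_apply (E := E) (G := G),
    eventually_extChartAt_one_mem_target (E := E) (G := G)] with x h1 h2
  rw [h1 v, mpullbackWithin_apply]
  rw [ContinuousLinearMap.inverse_eq (mfderivWithin_extChartAt_symm_comp_mfderiv_extChartAt h2)
    (mfderiv_extChartAt_comp_mfderivWithin_extChartAt_symm h2)]
  rfl

theorem fderiv_chartMul_one_apply (v : E) :
    fderiv ℝ (chartMul E G) (extChartAt 𝓘(ℝ, E) (1 : G) 1, extChartAt 𝓘(ℝ, E) (1 : G) 1) (0, v)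
      = v := by
  have h1 : HasFDerivAt (fun y ↦ chartMul E G (extChartAt 𝓘(ℝ, E) (1 : G) 1, y)) _
      (extChartAt 𝓘(ℝ, E) (1 : G) 1) :=
    (contDiffAt_chartMul.differentiableAt (by norm_num)).hasFDerivAt.comp _
      (hasFDerivAt_prodMk_right _ _)
  have h2 : HasFDerivAt (fun y ↦ chartMul E G (extChartAt 𝓘(ℝ, E) (1 : G) 1, y))
      (ContinuousLinearMap.id ℝ E) (extChartAt 𝓘(ℝ, E) (1 : G) 1) :=
    (hasFDerivAt_id _).congr_of_eventuallyEq chartMul_left_eventually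
  simpa using congr($(h1.unique h2) v)

variable (G) in
/-- The bracket of the Lie algebra of a Lie group, as an operation on the model space. -/
noncomputable def groupBracket (v w : E) : E :=
  mlieBracket 𝓘(ℝ, E) (mulInvariantVectorField (G := G) v) (mulInvariantVectorField (G := G) w) 1

theorem groupBracket_eq_fderiv_chartMul (v w : E) :
    groupBracket G v w =
      fderiv ℝ (fun x ↦ fderiv ℝ (chartMul E G) (x, extChartAt 𝓘(ℝ, E) (1 : G) 1) (0, w))
          (extChartAt 𝓘(ℝ, E) (1 : G) 1) v -
        fderiv ℝ (fun x ↦ fderiv ℝ (chartMul E G) (x, extChartAt 𝓘(ℝ, E) (1 : G) 1) (0, v))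
          (extChartAt 𝓘(ℝ, E) (1 : G) 1) w := by
  have : IsManifold 𝓘(ℝ, E) 1 G := .of_le (n := ∞) ENat.LEInfty.out
  have h1 : (extChartAt 𝓘(ℝ, E) (1 : G)).symm ⁻¹' Set.univ ∩ Set.range 𝓘(ℝ, E) = Set.univ := by
    simp
  -- The manifold bracket is the bracket of the fields pulled back to the chart, transported by the
  -- derivative A of the chart at 1, which is the identity. Only the germs of V and W matter.
  obtain ⟨A, V, W, hA, hV, hW, h2⟩ : ∃ (A : E →L[ℝ] E) (V W : E → E),
      A = ContinuousLinearMap.id ℝ E ∧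
      V =ᶠ[𝓝 (extChartAt 𝓘(ℝ, E) (1 : G) 1)]
        (fun x ↦ fderiv ℝ (chartMul E G) (x, extChartAt 𝓘(ℝ, E) (1 : G) 1) (0, v)) ∧
      W =ᶠ[𝓝 (extChartAt 𝓘(ℝ, E) (1 : G) 1)]
        (fun x ↦ fderiv ℝ (chartMul E G) (x, extChartAt 𝓘(ℝ, E) (1 : G) 1) (0, w)) ∧
      groupBracket G v w = A.inverse (lieBracketWithin ℝ V W
        ((extChartAt 𝓘(ℝ, E) (1 : G)).symm ⁻¹' Set.univ ∩ Set.range 𝓘(ℝ, E))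
        (extChartAt 𝓘(ℝ, E) (1 : G) 1)) :=
    ⟨_, _, _, mfderiv_extChartAt_self, mpullbackWithin_mulInvariantVectorField_eventuallyEq v,
      mpullbackWithin_mulInvariantVectorField_eventuallyEq w, mlieBracketWithin_apply⟩
  rw [h2, hA, ContinuousLinearMap.inverse_id, h1, lieBracketWithin_univ,
    hV.lieBracket_vectorField_eq hW, lieBracket, fderiv_chartMul_one_apply,
    fderiv_chartMul_one_apply]
  rfl

/-- The derivative of the adjoint action is the bracket of the Lie algebra. -/
theorem fderiv_lieGroupAd (v w : E) :
    fderiv ℝ (fun x ↦ lieGroupAd E ((extChartAt 𝓘(ℝ, E) (1 : G)).symm x) w)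
      (extChartAt 𝓘(ℝ, E) (1 : G) 1) v = groupBracket G v w := by
  have hcont := continuousAt_extChartAt_symm (I := 𝓘(ℝ, E)) (1 : G)
  have : IsTopologicalGroup G := topologicalGroup_of_lieGroup 𝓘(ℝ, E) ∞
  rw [groupBracket_eq_fderiv_chartMul, ← fderiv_conj_of_local_group_law
    contDiffAt_chartMul contDiffAt_chartConj chartMul_right_eventually chartMul_left_eventually
    ?_ ?_]
  · refine congr($(Filter.EventuallyEq.fderiv_eq ?_) v)
    exact fderiv_chartConj_apply.mono fun _ h ↦ (h w).symm
  · filter_upwards with x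
    simp only [chartConj, extChartAt_one_symm_self, mul_one, mul_inv_cancel]
  -- The identity (xyx⁻¹)x = xy passes to coordinates where xyx⁻¹ stays in the chart domain, which
  -- holds near (1, 1) by continuity.
  · have h2 : ContinuousAt (fun z : E × E ↦ (extChartAt 𝓘(ℝ, E) (1 : G)).symm z.1 *
        (extChartAt 𝓘(ℝ, E) (1 : G)).symm z.2 * ((extChartAt 𝓘(ℝ, E) (1 : G)).symm z.1)⁻¹)
        (extChartAt 𝓘(ℝ, E) (1 : G) 1, extChartAt 𝓘(ℝ, E) (1 : G) 1) := by
      have h3 := ContinuousAt.comp (f := Prod.fst)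
        (x := (extChartAt 𝓘(ℝ, E) (1 : G) 1, extChartAt 𝓘(ℝ, E) (1 : G) 1)) hcont continuousAt_fst
      have h4 := ContinuousAt.comp (f := Prod.snd)
        (x := (extChartAt 𝓘(ℝ, E) (1 : G) 1, extChartAt 𝓘(ℝ, E) (1 : G) 1)) hcont continuousAt_snd
      exact (h3.mul h4).mul h3.inv
    have h5 : (extChartAt 𝓘(ℝ, E) (1 : G)).source ∈ 𝓝
        ((extChartAt 𝓘(ℝ, E) (1 : G)).symm (extChartAt 𝓘(ℝ, E) (1 : G) 1) *
        (extChartAt 𝓘(ℝ, E) (1 : G)).symm (extChartAt 𝓘(ℝ, E) (1 : G) 1) *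
        ((extChartAt 𝓘(ℝ, E) (1 : G)).symm (extChartAt 𝓘(ℝ, E) (1 : G) 1))⁻¹) := by
      rw [extChartAt_one_symm_self]
      simpa using extChartAt_source_mem_nhds (I := 𝓘(ℝ, E)) (1 : G)
    filter_upwards [h2.eventually h5] with z hz
    rw [chartMul, chartConj, chartMul, PartialEquiv.left_inv _ hz]
    simp

end LocalLieGroup

/-! ### Averaging an inner product over a compact Lie group. -/

section CompactLieGroup
open MeasureTheory
variable {E : Type*} [NormedAddCommGroup E] [InnerProductSpace ℝ E]
  {G : Type*} [TopologicalSpace G] [ChartedSpace E G] [Group G]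
  [LieGroup 𝓘(ℝ, E) ∞ G]

theorem continuous_inner_lieGroupAd_inv (v w : E) : Continuous fun g : G ↦
    inner ℝ (lieGroupAd E g⁻¹ v) (lieGroupAd E g⁻¹ w) := by
  have : IsTopologicalGroup G := topologicalGroup_of_lieGroup 𝓘(ℝ, E) ∞
  exact ((continuous_lieGroupAd v).comp continuous_inv).inner
    ((continuous_lieGroupAd w).comp continuous_inv)

variable [CompactSpace G] [MeasurableSpace G] [BorelSpace G]

theorem integrable_inner_lieGroupAd_inv (μ : Measure G) [IsFiniteMeasure μ] (v w : E) :
    Integrable (fun g : G ↦ inner ℝ (lieGroupAd E g⁻¹ v) (lieGroupAd E g⁻¹ w)) μ :=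
  (continuous_inner_lieGroupAd_inv v w).integrable_of_hasCompactSupport
    (HasCompactSupport.of_compactSpace _)

/-- The average of the inner product under the adjoint action of a compact Lie group. -/
noncomputable def averagedForm (μ : Measure G) [IsFiniteMeasure μ] : LinearMap.BilinForm ℝ E :=
  LinearMap.mk₂ ℝ (fun v w ↦ ∫ g : G, inner ℝ (lieGroupAd E g⁻¹ v) (lieGroupAd E g⁻¹ w) ∂μ)
    (fun v₁ v₂ w ↦ by
      simp only [map_add, inner_add_left]
      exact integral_add (integrable_inner_lieGroupAd_inv μ _ _)
        (integrable_inner_lieGroupAd_inv μ _ _))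
    (fun c v w ↦ by
      simp only [map_smul, real_inner_smul_left, integral_const_mul, smul_eq_mul])
    (fun v w₁ w₂ ↦ by
      simp only [map_add, inner_add_right]
      exact integral_add (integrable_inner_lieGroupAd_inv μ _ _)
        (integrable_inner_lieGroupAd_inv μ _ _))
    (fun c v w ↦ by
      simp only [map_smul, real_inner_smul_right, integral_const_mul, smul_eq_mul])

theorem averagedForm_apply (μ : Measure G) [IsFiniteMeasure μ] (v w : E) :
    averagedForm μ v w = ∫ g : G, inner ℝ (lieGroupAd E g⁻¹ v) (lieGroupAd E g⁻¹ w) ∂μ :=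
  rfl

theorem averagedForm_isSymm (μ : Measure G) [IsFiniteMeasure μ] :
    (averagedForm μ : LinearMap.BilinForm ℝ E).IsSymm :=
  ⟨fun v w ↦ by simp only [averagedForm_apply, real_inner_comm]⟩

theorem averagedForm_self_pos (μ : Measure G) [IsFiniteMeasure μ] [μ.IsOpenPosMeasure] {v : E}
    (hv : v ≠ 0) : 0 < averagedForm μ v v := by
  rw [averagedForm_apply]
  refine (continuous_inner_lieGroupAd_inv v v).integral_pos_of_hasCompactSupport_nonneg_nonzero
    (HasCompactSupport.of_compactSpace _) (fun g ↦ real_inner_self_nonneg) (x := 1) ?_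
  simpa [lieGroupAd_one] using hv

/-- Since Ad(g⁻¹)Ad(k) = Ad((k⁻¹g)⁻¹), the change of variable is a left translation. The inverse in
the integrand is there so that left invariance of μ suffices. -/
theorem averagedForm_lieGroupAd (μ : Measure G) [IsFiniteMeasure μ] [μ.IsMulLeftInvariant]
    (k : G) (v w : E) :
    averagedForm μ (lieGroupAd E k v) (lieGroupAd E k w) = averagedForm μ v w := by
  have : IsTopologicalGroup G := topologicalGroup_of_lieGroup 𝓘(ℝ, E) ∞
  rw [averagedForm_apply, averagedForm_apply, ← integral_mul_left_eq_self
    (fun g : G ↦ inner ℝ (lieGroupAd E g⁻¹ v) (lieGroupAd E g⁻¹ w)) k⁻¹]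
  simp only [mul_inv_rev, inv_inv, lieGroupAd_mul, ContinuousLinearMap.comp_apply]

/-- The function g ↦ B(Ad(g)y, Ad(g)z) is constant. Its derivative at the identity along x is the
left-hand side. -/
theorem averagedForm_groupBracket_add [FiniteDimensional ℝ E] (μ : Measure G) [IsFiniteMeasure μ]
    [μ.IsMulLeftInvariant] (x y z : E) :
    averagedForm μ (groupBracket G x y) z + averagedForm μ y (groupBracket G x z) = 0 := by
  let B : E →L[ℝ] E →L[ℝ] ℝ := LinearMap.toContinuousBilinearMap (averagedForm μ)
  have hB : ∀ v w, B v w = averagedForm μ v w := fun v w ↦ rfl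
  have hd := fun v : E ↦ (differentiableAt_lieGroupAd (G := G) v).hasFDerivAt
  have h1 := B.hasFDerivAt_of_bilinear (hd y) (hd z)
  have h2 : (fun x ↦ B (lieGroupAd E ((extChartAt 𝓘(ℝ, E) (1 : G)).symm x) y)
      (lieGroupAd E ((extChartAt 𝓘(ℝ, E) (1 : G)).symm x) z)) = fun _ ↦ B y z := by
    ext x
    rw [hB, averagedForm_lieGroupAd, hB]
  rw [h2] at h1
  have h3 := congr($(h1.unique (hasFDerivAt_const _ _)) x)
  simp only [extChartAt_one_symm_self, lieGroupAd_one, add_apply,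
    ContinuousLinearMap.precompR_apply, ContinuousLinearMap.precompL_apply,
    ContinuousLinearMap.compL_apply, ContinuousLinearMap.comp_apply,
    ContinuousLinearMap.id_apply, zero_apply, fderiv_lieGroupAd, hB] at h3
  rwa [add_comm]

end CompactLieGroup

theorem exists_invariant_inner_groupBracket {E : Type*} [NormedAddCommGroup E]
    [InnerProductSpace ℝ E] [FiniteDimensional ℝ E] (G : Type*) [TopologicalSpace G]
    [ChartedSpace E G] [Group G] [LieGroup 𝓘(ℝ, E) ∞ G] [CompactSpace G] :
    ∃ B : LinearMap.BilinForm ℝ E, B.IsSymm ∧ (∀ x, x ≠ 0 → 0 < B x x) ∧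
      ∀ x y z, B (groupBracket G x y) z + B y (groupBracket G x z) = 0 := by
  have : IsTopologicalGroup G := topologicalGroup_of_lieGroup 𝓘(ℝ, E) ∞
  borelize G
  exact ⟨averagedForm (MeasureTheory.Measure.haar (G := G)), averagedForm_isSymm _,
    fun _ ↦ averagedForm_self_pos _, averagedForm_groupBracket_add _⟩

theorem IsCompactLieAlgebra.lieCompactlyEmbedded {L : Type v} [LieRing L] [LieAlgebra ℝ L]
    (H : IsCompactLieAlgebra.{w} L) (h : LieSubalgebra ℝ L) : LieCompactlyEmbedded h := by
  obtain ⟨n, G, _, _, _, _, _, _, ⟨e⟩⟩ := H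
  have := lieGroup_minSmoothness n G
  obtain ⟨B, hB, hpos, hskew⟩ := exists_invariant_inner_groupBracket
    (E := EuclideanSpace ℝ (Fin n)) G
  let f : L →ₗ[ℝ] EuclideanSpace ℝ (Fin n) := e.toLinearEquiv.toLinearMap
  have hf : ∀ x y, f ⁅x, y⁆ = groupBracket G (f x) (f y) := fun x y ↦
    LieEquiv.map_lie e x y
  have hf0 : ∀ x, x ≠ 0 → f x ≠ 0 := fun x hx ↦ by
    exact e.toLinearEquiv.map_ne_zero_iff.2 hx
  refine ⟨B.compl₁₂ f f, ⟨fun x y ↦ hB.eq (f x) (f y)⟩, fun x hx ↦ hpos _ (hf0 x hx),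
    fun x _ y z ↦ ?_⟩
  simp only [LinearMap.compl₁₂_apply, hf]
  exact hskew _ _ _

/-! ### Assembly of the cases. -/

theorem theorem4p1 :
    (∀ (K : Type u) [Field K] (g : Type v) [LieRing g] [LieAlgebra K g] (h : LieSubalgebra K g),
      (LiePerfect K h ∨
        (FiniteDimensional K g ∧ CharZero K ∧
          ∀ x ∈ LieAlgebra.radical K h, (x : g) ∈ LieAlgebra.center K g)) →
      LieSelfNormalizing h.normalizer) ∧
    (∀ (g : Type v) [LieRing g] [LieAlgebra ℝ g] [FiniteDimensional ℝ g] (h : LieSubalgebra ℝ g),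
      (LieHasAdaptedForm h ∨
        IsCompactLieAlgebra.{w} g ∨
        LieCompactlyEmbedded h ∨
        (LieAlgebra.IsSemisimple ℝ g ∧ ∃ θ : g ≃ₗ⁅ℝ⁆ g, IsCartanInvolution θ ∧
          (Module.End.eigenspace ((θ : g →ₗ⁅ℝ⁆ g) : g →ₗ[ℝ] g) 1 ≤ h.toSubmodule ∨
            Module.End.eigenspace ((θ : g →ₗ⁅ℝ⁆ g) : g →ₗ[ℝ] g) (-1) ≤ h.toSubmodule))) →
      LieSelfNormalizing h.normalizer) := by
  refine ⟨?_, ?_⟩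
  · rintro K _ g _ _ h (H | ⟨_, _, H⟩)
    · exact lieSelfNormalizing_normalizer_of_perfect H
    · exact lieSelfNormalizing_normalizer_of_radical_le_center H
  · rintro g _ _ _ h (H | H | H | ⟨-, θ, hθ, H⟩)
    · exact H.lieSelfNormalizing
    · exact (H.lieCompactlyEmbedded h).lieHasAdaptedForm.lieSelfNormalizing
    · exact H.lieHasAdaptedForm.lieSelfNormalizing
    · refine (LieHasAdaptedForm.of_cartanInvolution hθ (H.imp (fun H x hx ↦ H ?_)
        fun H x hx ↦ H ?_)).lieSelfNormalizing <;>
      simpa [Module.End.mem_eigenspace_iff] using hx
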